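/- **Model.** There are $k$ sites $P_1,\dots,P_k$; site $P_i$ holds a local input $x_i$. A deterministic message-passing protocol proceeds in steps. The transcript so far (the chronological list of messages with their senders and receivers) determines which site speaks next, or that the protocol halts and which site reports the answer. The speaking site chooses a receiver and a nonempty bit string to send to it, as a function of its own input and of the messages that it has itself sent or received; other sites do not see this message. The reported answer is a function of the reporting site's own input and of the messages it has sent or received. The cost is the total number of bits in all messages; sites have unlimited memory and computational power. A randomized protocol draws random tapes for the sites from a probability space and, for each outcome of the tapes, follows a deterministic protocol (independent private tapes are a special case; shared random bits are also allowed). For a function $f$ on a set of legal inputs $(x_1,\dots,x_k)$, $R^{\delta}(f)$ is the least $C$ such that some randomized protocol always halts after at most $C$ bits, for every legal input and every outcome of the tapes, and on every legal input reports $f(x_1,\dots,x_k)$ except with probability at most $\delta$ over the random tapes. **Problem.** In cycle-freeness with edge duplication, with parameters $n,m,k$, site $P_i$ holds a graph $G_i$ on the common vertex set $\{1,\dots,n\}$; the same edge may be held by any number of sites. The legal inputs are all $(G_1,\dots,G_k)$ for which $G=G_1\cup\dots\cup G_k$ has at most $m$ distinct edges (no restriction if $m\ge\binom n2$). The sites must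 decide whether $G$ contains no cycle. **Theorem.** There are absolute constants $c_0>0$ and $c>0$ such that for all natural numbers $n,m,k$ with $k\ge 2$, $m\ge n$ and $c_0\log_2 n\le k\le\min\{n,m\}$, $$R^{1/3}(\text{cycle-freeness with edge duplication})\ \ge\ c\cdot\frac{kn}{\log_2 k}.$$ That is, $R^{1/3}(\text{cycle-freeness with edge duplication})=\Omega(kn/\log k)$. -/

import Mathlib

open scoped ENNReal

/-- A message: a nonempty string of bits. -/
abbrev BitMessage : Type := {w : List Bool // w ≠ []}

/-- One communication event among `k` sites: `sender` sends `msg` to `receiver`. -/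
structure CommEvent (k : ℕ) where
  sender : Fin k
  receiver : Fin k
  msg : BitMessage

/-- The chronological list of the messages exchanged so far by the `k` sites. -/
abbrev Transcript (k : ℕ) : Type := List (CommEvent k)

namespace Transcript

/-- Total number of bits of all messages of a transcript. -/
def bits {k : ℕ} (h : Transcript k) : ℕ := (h.map fun e => e.msg.1.length).sum

/-- What site `i` sees of a transcript: exactly the messages that it sent or received. -/
def view {k : ℕ} (i : Fin k) (h : Transcript k) : Transcript k :=
  h.filter fun e => decide (e.sender = i ∨ e.receiver = i)

end Transcript

/-- What happens next: some site speaks, or the protocol halts and some site reports the answer. -/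
inductive NextMove (k : ℕ) where
  | speak (i : Fin k) : NextMove k
  | halt (j : Fin k) : NextMove k

/-- A deterministic protocol in the message-passing model with `k` sites, local inputs in `X` and
answers in `O`. The transcript specifies who speaks next (or who reports the answer). The speaker
chooses a receiver and a message from its own input and its own view only: messages are
point-to-point and are not seen by third sites. -/
structure DetProtocol (k : ℕ) (X O : Type) where
  next : Transcript k → NextMove k
  send : Fin k → X → Transcript k → Fin k × BitMessage
  output : Fin k → X → Transcript k → O

namespace DetProtocol

variable {k : ℕ} {X O : Type}

/-- One step of the execution on input `x`; nothing changes once the protocol has halted. -/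
def step (P : DetProtocol k X O) (x : Fin k → X) (h : Transcript k) : Transcript k :=
  match P.next h with
  | NextMove.speak i =>
      h ++ [⟨i, (P.send i (x i) (h.view i)).1, (P.send i (x i) (h.view i)).2⟩]
  | NextMove.halt _ => h

/-- The transcript after `t` steps of the execution on input `x`. -/
def run (P : DetProtocol k X O) (x : Fin k → X) (t : ℕ) : Transcript k :=
  (P.step x)^[t] []

/-- On input `x` the protocol halts, and its final transcript has at most `C` bits. -/
def HaltsWithin (P : DetProtocol k X O) (x : Fin k → X) (C : ℕ) : Prop :=
  ∃ t j, P.next (P.run x t) = NextMove.halt j ∧ (P.run x t).bits ≤ C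

/-- On input `x` the protocol halts, and the reporting site, which knows only its own input and
its own view, answers `o`. -/
def Answers (P : DetProtocol k X O) (x : Fin k → X) (o : O) : Prop :=
  ∃ t j, P.next (P.run x t) = NextMove.halt j ∧ P.output j (x j) ((P.run x t).view j) = o

end DetProtocol

/-- A randomized protocol: all random tapes of the sites are drawn jointly from a probability
space, and each outcome of the tapes gives a deterministic protocol. Independent private tapes are
the special case in which site `i` uses only the `i`-th coordinate; shared coins are allowed. -/
structure RandProtocol (k : ℕ) (X O : Type) where
  Tape : Type
  [measurableSpace : MeasurableSpace Tape]
  law : MeasureTheory.Measure Tape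
  [isProbabilityMeasure : MeasureTheory.IsProbabilityMeasure law]
  det : Tape → DetProtocol k X O

namespace RandProtocol

variable {k : ℕ} {X O : Type}

/-- At most `C` bits are exchanged, on every legal input and for every outcome of the tapes. -/
def CostAtMost (P : RandProtocol k X O) (D : Set (Fin k → X)) (C : ℕ) : Prop :=
  ∀ x ∈ D, ∀ ω, (P.det ω).HaltsWithin x C

/-- `P` computes `f` with error probability at most `δ` on every legal input, the probability
being over the random tapes only. -/
def ComputesWithError (P : RandProtocol k X O) (D : Set (Fin k → X)) (f : (Fin k → X) → O)
    (δ : ℝ≥0∞) : Prop :=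
  ∀ x ∈ D, P.law {ω | ¬ (P.det ω).Answers x (f x)} ≤ δ

end RandProtocol

/-- The randomized `δ`-error communication complexity of `f` on the set `D` of legal inputs: the
least worst-case number of bits of a randomized protocol with error at most `δ`. -/
noncomputable def randCC {k : ℕ} {X O : Type} (δ : ℝ≥0∞) (D : Set (Fin k → X))
    (f : (Fin k → X) → O) : ℕ∞ :=
  ⨅ (C : ℕ) (_ : ∃ P : RandProtocol k X O, P.CostAtMost D C ∧ P.ComputesWithError D f δ), (C : ℕ∞)

/-- The graph whose edges are distributed among the sites: the union of the local graphs. -/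
def unionGraph {k n : ℕ} (G : Fin k → SimpleGraph (Fin n)) : SimpleGraph (Fin n) := ⨆ i, G i

/-- The inputs with edge duplication: arbitrary `k`-tuples of local graphs on `n` vertices (the
same edge may be held by any number of sites) whose union has at most `m` distinct edges. -/
def duplicationInputs (k n m : ℕ) : Set (Fin k → SimpleGraph (Fin n)) :=
  {G | (unionGraph G).edgeSet.ncard ≤ m}

open Classical in
/-- Cycle-freeness: is the union of the local graphs without cycles? -/
noncomputable def cycleFreeness {k n : ℕ} (G : Fin k → SimpleGraph (Fin n)) : Bool :=
  decide (unionGraph G).IsAcyclic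

open Finset

section Corruption

variable {ι : Type*} [DecidableEq ι]

/-- Coordinatewise conjunction. -/
def mask (d w : ι → Bool) : ι → Bool := fun j => d j && w j

/-- Coordinatewise negation. -/
def neg (d : ι → Bool) : ι → Bool := fun j => !(d j)

theorem mask_update_true (d w : ι → Bool) (j : ι) :
    mask (Function.update d j true) (Function.update w j true) =
      Function.update (mask d w) j true := by
  funext l; by_cases h : l = j
  · subst h; simp [mask]
  · simp [mask, h]

theorem mask_update_false (d w : ι → Bool) (j : ι) (b : Bool) :
    mask (Function.update d j b) (Function.update w j false) =
      mask (Function.update d j false) w := by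
  funext l; by_cases h : l = j
  · subst h; simp [mask]
  · simp [mask, h]

theorem neg_update (d : ι → Bool) (j : ι) (b : Bool) :
    neg (Function.update d j b) = Function.update (neg d) j (!b) := by
  funext l; by_cases h : l = j
  · subst h; simp [neg]
  · simp [neg, h]

variable [Fintype ι]

/-- The average of a real function on a finite type. -/
noncomputable def avg {α : Type*} [Fintype α] (F : α → ℝ) : ℝ :=
  (Fintype.card α : ℝ)⁻¹ * ∑ a, F a

theorem avg_mono {α : Type*} [Fintype α] {F G : α → ℝ} (h : ∀ a, F a ≤ G a) :
    avg F ≤ avg G :=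
  mul_le_mul_of_nonneg_left (sum_le_sum fun a _ => h a) (by positivity)

theorem avg_add {α : Type*} [Fintype α] (F G : α → ℝ) :
    avg (fun a => F a + G a) = avg F + avg G := by
  simp [avg, sum_add_distrib, mul_add]

theorem avg_sub {α : Type*} [Fintype α] (F G : α → ℝ) :
    avg (fun a => F a - G a) = avg F - avg G := by
  simp [avg, mul_sub]

theorem avg_const_mul {α : Type*} [Fintype α] (c : ℝ) (F : α → ℝ) :
    avg (fun a => c * F a) = c * avg F := by
  simp only [avg, ← mul_sum]; ring

theorem avg_mul_const {α : Type*} [Fintype α] (c : ℝ) (F : α → ℝ) :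
    avg (fun a => F a * c) = avg F * c := by
  simp only [avg, ← sum_mul]; ring

theorem avg_const {α : Type*} [Fintype α] [Nonempty α] (c : ℝ) :
    avg (fun _ : α => c) = c := by
  simp [avg]

theorem avg_sum {α β : Type*} [Fintype α] (s : Finset β) (F : β → α → ℝ) :
    avg (fun a => ∑ b ∈ s, F b a) = ∑ b ∈ s, avg (F b) := by
  simp only [avg, ← mul_sum]; rw [sum_comm]

theorem avg_nonneg {α : Type*} [Fintype α] {F : α → ℝ} (h : ∀ a, 0 ≤ F a) : 0 ≤ avg F :=
  mul_nonneg (by positivity) (sum_nonneg fun a _ => h a)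

theorem avg_prod {α β : Type*} [Fintype α] [Fintype β] (F : α → β → ℝ) :
    avg (fun p : α × β => F p.1 p.2) = avg fun a => avg fun b => F a b := by
  simp only [avg, Fintype.sum_prod_type, Fintype.card_prod, Nat.cast_mul, mul_inv, ← mul_sum]
  ring

/-- Averaging over Boolean vectors may be done by averaging over one coordinate first. -/
theorem avg_update (j : ι) (F : (ι → Bool) → ℝ) :
    avg F = (avg (fun w => F (Function.update w j true)) +
      avg fun w => F (Function.update w j false)) / 2 := by
  have hflip : avg (fun w => F (Function.update w j (!(w j)))) = avg F := by
    unfold avg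
    congr 1
    let e : Equiv.Perm (ι → Bool) := Function.Involutive.toPerm
      (fun w => Function.update w j (!(w j))) (by intro w; simp)
    exact Equiv.sum_comp e F
  have : avg (fun w => F (Function.update w j true)) +
      avg (fun w => F (Function.update w j false)) = avg F + avg F := by
    refine Eq.trans ?_ (congrArg (avg F + ·) hflip)
    rw [← avg_add]
    refine Eq.trans ?_ (avg_add _ _)
    congr 1
    funext w
    have hw := Function.update_eq_self j w
    cases h : w j <;> rw [h] at hw <;> simp [hw, add_comm]
  linarith

/-- The sign attached to a bit. -/
def sgn (b : Bool) : ℝ := if b then 1 else -1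

/-- The average of `f` over the vectors supported on `d`. -/
noncomputable def maskAvg (f : (ι → Bool) → ℝ) (d : ι → Bool) : ℝ := avg fun w => f (mask d w)

/-- The average of `f` over the vectors supported on `d`, with coordinate `j` set to one. -/
noncomputable def maskAvgOne (f : (ι → Bool) → ℝ) (d : ι → Bool) (j : ι) : ℝ :=
  avg fun w => f (Function.update (mask d w) j true)

/-- The degree-one Fourier coefficients of `f` on the vectors supported on `d`. -/
noncomputable def maskCoeff (f : (ι → Bool) → ℝ) (d : ι → Bool) (j : ι) : ℝ :=
  avg fun w => sgn (w j) * f (mask d w)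

theorem maskAvg_update_true (f : (ι → Bool) → ℝ) (d : ι → Bool) (j : ι) :
    maskAvg f (Function.update d j true) =
      (maskAvgOne f d j + maskAvg f (Function.update d j false)) / 2 := by
  unfold maskAvg maskAvgOne
  rw [avg_update j]
  simp only [mask_update_true, mask_update_false]

theorem maskCoeff_update_true (f : (ι → Bool) → ℝ) (d : ι → Bool) (j : ι) :
    maskCoeff f (Function.update d j true) j =
      (maskAvgOne f d j - maskAvg f (Function.update d j false)) / 2 := by
  unfold maskCoeff maskAvgOne maskAvg
  rw [avg_update j]
  simp only [mask_update_true, mask_update_false, Function.update_self, sgn]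
  simp [avg]
  ring

theorem avg_exp_signs (t : ℝ) (s : ι → ℝ) (hs : ∀ j, s j = 1 ∨ s j = -1) :
    avg (fun w : ι → Bool => Real.exp (t * ∑ j, s j * sgn (w j))) =
      Real.cosh t ^ Fintype.card ι := by
  have h1 : ∀ w : ι → Bool, Real.exp (t * ∑ j, s j * sgn (w j)) =
      ∏ j, Real.exp (t * (s j * sgn (w j))) := by
    intro w; rw [mul_sum, Real.exp_sum]
  have h2 : ∑ w : ι → Bool, ∏ j, Real.exp (t * (s j * sgn (w j))) =
      ∏ j, ∑ b : Bool, Real.exp (t * (s j * sgn b)) := by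
    rw [Finset.prod_univ_sum, Fintype.piFinset_univ]
  have h3 : ∀ j, ∑ b : Bool, Real.exp (t * (s j * sgn b)) = 2 * Real.cosh t := by
    intro j
    rw [Real.cosh_eq]
    rcases hs j with h | h <;> simp [h, sgn] <;> ring
  simp only [avg, h1, h2, h3, prod_const, Fintype.card_pi, Fintype.card_bool]
  simp [mul_pow]

theorem sum_abs_maskCoeff_le {f : (ι → Bool) → ℝ} (h0 : ∀ x, 0 ≤ f x) (h1 : ∀ x, f x ≤ 1)
    (d : ι → Bool) {t : ℝ} (ht : 0 < t) :
    ∑ j, |maskCoeff f d j| ≤ t * Fintype.card ι * maskAvg f d +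
      Real.exp (-(t ^ 2 * Fintype.card ι / 2)) / t := by
  set n := (Fintype.card ι : ℝ) with hn
  let s : ι → ℝ := fun j => if 0 ≤ maskCoeff f d j then 1 else -1
  have hs : ∀ j, s j = 1 ∨ s j = -1 := by intro j; by_cases h : 0 ≤ maskCoeff f d j <;> simp [s, h]
  have habs : ∀ j, |maskCoeff f d j| = s j * maskCoeff f d j := by
    intro j
    by_cases h : 0 ≤ maskCoeff f d j
    · simp [s, h, abs_of_nonneg h]
    · simp [s, h, abs_of_neg (not_le.1 h)]
  have key : t * ∑ j, |maskCoeff f d j| =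
      avg fun w => (t * ∑ j, s j * sgn (w j)) * f (mask d w) := by
    have hj : ∀ j ∈ univ, t * |maskCoeff f d j| =
        avg fun w => t * (s j * (sgn (w j) * f (mask d w))) := fun j _ => by
      rw [habs, avg_const_mul, avg_const_mul, maskCoeff]
    rw [mul_sum, sum_congr rfl hj, ← avg_sum]
    congr 1; funext w
    rw [mul_sum, sum_mul]
    exact sum_congr rfl fun j _ => by ring
  have hpt : ∀ w : ι → Bool, (t * ∑ j, s j * sgn (w j)) * f (mask d w) ≤
      Real.exp (-(t ^ 2 * n)) * Real.exp (t * ∑ j, s j * sgn (w j)) +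
        t ^ 2 * n * f (mask d w) := by
    intro w
    set u := t * ∑ j, s j * sgn (w j)
    have h2 := Real.add_one_le_exp (u - t ^ 2 * n)
    have h3 : Real.exp (u - t ^ 2 * n) * f (mask d w) ≤ Real.exp (u - t ^ 2 * n) :=
      mul_le_of_le_one_right (Real.exp_pos _).le (h1 _)
    have h4 : Real.exp (-(t ^ 2 * n)) * Real.exp u = Real.exp (u - t ^ 2 * n) := by
      rw [← Real.exp_add]; ring_nf
    nlinarith [h0 (mask d w), mul_le_mul_of_nonneg_right h2 (h0 (mask d w))]
  have hcosh : Real.cosh t ^ Fintype.card ι ≤ Real.exp (t ^ 2 * n / 2) := by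
    calc Real.cosh t ^ Fintype.card ι ≤ Real.exp (t ^ 2 / 2) ^ Fintype.card ι :=
          pow_le_pow_left₀ (Real.cosh_pos t).le (Real.cosh_le_exp_half_sq t) _
      _ = _ := by rw [← Real.exp_nat_mul]; congr 1; rw [hn]; ring
  have hmain : t * ∑ j, |maskCoeff f d j| ≤
      Real.exp (-(t ^ 2 * n / 2)) + t ^ 2 * n * maskAvg f d := by
    rw [key]
    refine (avg_mono hpt).trans ?_
    rw [avg_add, avg_const_mul, avg_const_mul, avg_exp_signs t s hs]
    have : Real.exp (-(t ^ 2 * n)) * Real.exp (t ^ 2 * n / 2) = Real.exp (-(t ^ 2 * n / 2)) := by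
      rw [← Real.exp_add]; ring_nf
    have := mul_le_mul_of_nonneg_left hcosh (Real.exp_pos (-(t ^ 2 * n))).le
    simp only [maskAvg]
    linarith
  have : ∑ j, |maskCoeff f d j| = (t * ∑ j, |maskCoeff f d j|) / t := by field_simp
  rw [this, div_le_iff₀ ht]
  refine hmain.trans (le_of_eq ?_)
  field_simp
  ring

theorem mul_corner_ge {a₀ a₁ b₀ b₁ : ℝ} (ha₀ : 0 ≤ a₀) (ha₁ : 0 ≤ a₁) (hb₀ : 0 ≤ b₀)
    (hb₁ : 0 ≤ b₁) :
    ((a₁ + a₀) / 2 * b₀ + a₀ * ((b₁ + b₀) / 2)) / 2 -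
      5 / 2 * (|(a₁ - a₀) / 2| * b₀ + |(b₁ - b₀) / 2| * a₀) ≤ a₁ * b₁ := by
  rcases abs_cases ((a₁ - a₀) / 2) with ⟨h1, h1'⟩ | ⟨h1, h1'⟩ <;>
  rcases abs_cases ((b₁ - b₀) / 2) with ⟨h2, h2'⟩ | ⟨h2, h2'⟩ <;> rw [h1, h2]
  · nlinarith [mul_nonneg ha₀ hb₀, mul_nonneg (by linarith : 0 ≤ a₁ - a₀) (by linarith : 0 ≤ b₁ - b₀),
      mul_nonneg (by linarith : 0 ≤ a₁ - a₀) hb₀, mul_nonneg (by linarith : 0 ≤ b₁ - b₀) ha₀]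
  · nlinarith [mul_nonneg ha₀ hb₀, mul_nonneg (by linarith : 0 ≤ a₁ - a₀) hb₁,
      mul_nonneg (by linarith : 0 ≤ a₁ - a₀) hb₀, mul_nonneg (by linarith : 0 ≤ b₀ - b₁) ha₀]
  · nlinarith [mul_nonneg ha₀ hb₀, mul_nonneg (by linarith : 0 ≤ b₁ - b₀) ha₁,
      mul_nonneg (by linarith : 0 ≤ a₀ - a₁) hb₀, mul_nonneg (by linarith : 0 ≤ b₁ - b₀) ha₀]
  · nlinarith [mul_nonneg ha₀ hb₀, mul_nonneg (by linarith : 0 ≤ a₀ - a₁) (by linarith : 0 ≤ b₀ - b₁),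
      mul_nonneg (by linarith : 0 ≤ a₀ - a₁) hb₀, mul_nonneg (by linarith : 0 ≤ b₀ - b₁) ha₀]

/-- A large product of two functions on the disjoint pairs is also large on the pairs that meet
in one coordinate. -/
theorem corruption {f g : (ι → Bool) → ℝ} (hf0 : ∀ x, 0 ≤ f x) (hf1 : ∀ x, f x ≤ 1)
    (hg0 : ∀ x, 0 ≤ g x) (hg1 : ∀ x, g x ≤ 1) {t : ℝ} (ht : 0 < t) :
    Fintype.card ι * ((1 - 10 * t) * avg fun d => maskAvg f d * maskAvg g (neg d)) -
        10 * (Real.exp (-(t ^ 2 * Fintype.card ι / 2)) / t) ≤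
      ∑ j, avg fun d => maskAvgOne f d j * maskAvgOne g (neg d) j := by
  set n := (Fintype.card ι : ℝ) with hn
  set η := Real.exp (-(t ^ 2 * n / 2)) / t with hη
  have hη0 : 0 ≤ η := by positivity
  have nn : ∀ {h : (ι → Bool) → ℝ}, (∀ x, 0 ≤ h x) → ∀ d, 0 ≤ maskAvg h d :=
    fun hh d => avg_nonneg fun w => hh _
  have nn1 : ∀ {h : (ι → Bool) → ℝ}, (∀ x, 0 ≤ h x) → ∀ d j, 0 ≤ maskAvgOne h d j :=
    fun hh d j => avg_nonneg fun w => hh _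
  have le1 : ∀ {h : (ι → Bool) → ℝ}, (∀ x, h x ≤ 1) → ∀ d, maskAvg h d ≤ 1 := fun hh d =>
    (avg_mono fun w => hh _).trans (le_of_eq (avg_const 1))
  let M : (ι → Bool) → ℝ := fun d => maskAvg f d * maskAvg g (neg d)
  let E : ι → (ι → Bool) → ℝ := fun j d =>
    |maskCoeff f d j| * maskAvg g (neg d) + |maskCoeff g (neg d) j| * maskAvg f d
  have hE0 : ∀ j d, 0 ≤ |maskCoeff f d j| * maskAvg g (neg d) := fun j d =>
    mul_nonneg (abs_nonneg _) (nn hg0 _)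
  have hE1 : ∀ j d, 0 ≤ |maskCoeff g (neg d) j| * maskAvg f d := fun j d =>
    mul_nonneg (abs_nonneg _) (nn hf0 _)
  have hpair : ∀ j, avg M - 5 * avg (E j) ≤
      avg fun d => maskAvgOne f d j * maskAvgOne g (neg d) j := by
    intro j
    rw [avg_update j M, avg_update j (E j)]
    have : ∀ d, (M (Function.update d j true) + M (Function.update d j false)) / 2 -
        5 / 2 * (E j (Function.update d j true) + E j (Function.update d j false)) ≤
        maskAvgOne f d j * maskAvgOne g (neg d) j := by
      intro d
      refine le_trans ?_ (mul_corner_ge (nn hf0 (Function.update d j false)) (nn1 hf0 d j)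
        (nn hg0 (Function.update (neg d) j false)) (nn1 hg0 (neg d) j))
      have e1 := hE1 j (Function.update d j true)
      have e0 := hE0 j (Function.update d j false)
      simp only [M, E, neg_update, Bool.not_true, Bool.not_false, maskAvg_update_true,
        maskCoeff_update_true] at e1 e0 ⊢
      linarith
    have h := avg_mono this
    have e : avg (fun d => (M (Function.update d j true) + M (Function.update d j false)) / 2 -
        5 / 2 * (E j (Function.update d j true) + E j (Function.update d j false))) =
        (avg (fun d => M (Function.update d j true)) +
          avg fun d => M (Function.update d j false)) / 2 -
        5 / 2 * (avg (fun d => E j (Function.update d j true)) +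
          avg fun d => E j (Function.update d j false)) := by
      simp only [div_eq_mul_inv, avg_sub, avg_mul_const, avg_const_mul, avg_add]
    linarith
  have hsumE : ∑ j, avg (E j) ≤ 2 * t * n * avg M + 2 * η := by
    rw [← avg_sum]
    calc avg (fun d => ∑ j, E j d) ≤ avg fun d => 2 * t * n * M d + 2 * η := by
          refine avg_mono fun d => ?_
          simp only [E, sum_add_distrib, ← sum_mul]
          have a1 := mul_le_mul_of_nonneg_right (sum_abs_maskCoeff_le hf0 hf1 d ht)
            (nn hg0 (neg d))
          have a2 := mul_le_mul_of_nonneg_right (sum_abs_maskCoeff_le hg0 hg1 (neg d) ht)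
            (nn hf0 d)
          have a3 := mul_le_of_le_one_right hη0 (le1 hg1 (neg d))
          have a4 := mul_le_of_le_one_right hη0 (le1 hf1 d)
          rw [← hn, ← hη] at a1 a2
          simp only [M]
          linarith
      _ = _ := by rw [avg_add, avg_const_mul, avg_const]
  have := sum_le_sum fun j (_ : j ∈ univ) => hpair j
  rw [sum_sub_distrib, ← mul_sum, sum_const, card_univ, nsmul_eq_mul, ← hn] at this
  change n * ((1 - 10 * t) * avg M) - 10 * η ≤ _
  linarith

end Corruption

namespace DetProtocol

variable {k : ℕ} {X O : Type} (P : DetProtocol k X O)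

/-- The execution on input `x` ends with transcript `h`, and site `j` reports. -/
def EndsAt (x : Fin k → X) (h : Transcript k) (j : Fin k) : Prop :=
  ∃ t, P.run x t = h ∧ P.next h = NextMove.halt j

theorem run_succ (x : Fin k → X) (t : ℕ) : P.run x (t + 1) = P.step x (P.run x t) :=
  Function.iterate_succ_apply' _ _ _

theorem step_of_halt {x : Fin k → X} {h : Transcript k} {j : Fin k}
    (hj : P.next h = NextMove.halt j) : P.step x h = h := by
  simp [step, hj]

theorem step_of_speak {x : Fin k → X} {h : Transcript k} {i : Fin k}
    (hi : P.next h = NextMove.speak i) :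
    P.step x h = h ++ [⟨i, (P.send i (x i) (h.view i)).1, (P.send i (x i) (h.view i)).2⟩] := by
  simp [step, hi]

theorem run_add_of_halt {x : Fin k → X} {t : ℕ} {j : Fin k}
    (hj : P.next (P.run x t) = NextMove.halt j) (s : ℕ) : P.run x (t + s) = P.run x t := by
  induction s with
  | zero => rfl
  | succ s ih => rw [← add_assoc, run_succ, ih, P.step_of_halt hj]

variable {P}

theorem EndsAt.unique {x : Fin k → X} {h h' : Transcript k} {j j' : Fin k}
    (H : P.EndsAt x h j) (H' : P.EndsAt x h' j') : h = h' ∧ j = j' := by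
  obtain ⟨t, rfl, hj⟩ := H
  obtain ⟨t', rfl, hj'⟩ := H'
  have : P.run x t = P.run x t' := by
    rcases le_total t t' with hle | hle <;> obtain ⟨s, rfl⟩ := Nat.exists_eq_add_of_le hle
    · exact (P.run_add_of_halt hj s).symm
    · exact P.run_add_of_halt hj' s
  rw [this, hj'] at hj
  exact ⟨this, by injection hj with e; exact e.symm⟩

theorem HaltsWithin.exists_endsAt {x : Fin k → X} {C : ℕ} (H : P.HaltsWithin x C) :
    ∃ h j, P.EndsAt x h j ∧ h.bits ≤ C := by
  obtain ⟨t, j, hj, hC⟩ := H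
  exact ⟨_, j, ⟨t, rfl, hj⟩, hC⟩

theorem EndsAt.answers_iff {x : Fin k → X} {h : Transcript k} {j : Fin k}
    (H : P.EndsAt x h j) (o : O) : P.Answers x o ↔ P.output j (x j) (h.view j) = o := by
  constructor
  · rintro ⟨t, j', hj', ho⟩
    obtain ⟨rfl, rfl⟩ := H.unique ⟨t, rfl, hj'⟩
    exact ho
  · intro ho
    obtain ⟨t, rfl, hj⟩ := H
    exact ⟨t, j, hj, ho⟩

variable (P)

/-- The messages that site `i` sends in the view `v` are those it sends on local input `a`. -/
def Consistent (i : Fin k) (v : Transcript k) (a : X) : Prop :=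
  ∀ p e, p ++ [e] <+: v → e.sender = i → P.send i a p = (e.receiver, e.msg)

theorem view_append_singleton (i : Fin k) (h : Transcript k) (e : CommEvent k) :
    Transcript.view i (h ++ [e]) =
      if e.sender = i ∨ e.receiver = i then h.view i ++ [e] else h.view i := by
  by_cases he : e.sender = i ∨ e.receiver = i <;> simp [Transcript.view, List.filter_append, he]

theorem consistent_run (i : Fin k) (x : Fin k → X) (t : ℕ) :
    P.Consistent i ((P.run x t).view i) (x i) := by
  induction t with
  | zero => intro p e hp; simp [run, Transcript.view] at hp
  | succ t ih =>
    rw [run_succ]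
    cases hn : P.next (P.run x t) with
    | halt j => rwa [P.step_of_halt hn]
    | speak s =>
      rw [P.step_of_speak hn, view_append_singleton]
      split_ifs with hc
      · intro p e hp he
        rcases List.prefix_concat_iff.1 hp with h | h
        · obtain ⟨rfl, h2⟩ := List.append_inj' h rfl
          obtain rfl := List.singleton_inj.1 h2
          obtain rfl : s = i := he
          rfl
        · exact ih p e h he
      · exact ih

theorem run_eq_of_consistent {i : Fin k} {x x' : Fin k → X} (hx : ∀ j, j ≠ i → x j = x' j) (t : ℕ)
    (hc : P.Consistent i ((P.run x t).view i) (x' i)) : P.run x' t = P.run x t := by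
  induction t with
  | zero => rfl
  | succ t ih =>
    rw [run_succ] at hc
    rw [run_succ, run_succ]
    cases hn : P.next (P.run x t) with
    | halt j =>
      rw [P.step_of_halt hn] at hc ⊢
      rw [ih hc, P.step_of_halt hn]
    | speak s =>
      rw [P.step_of_speak hn, view_append_singleton] at hc
      have hc' : P.Consistent i ((P.run x t).view i) (x' i) := by
        split_ifs at hc
        · exact fun p e hp he => hc p e (hp.trans (List.prefix_append _ _)) he
        · exact hc
      rw [ih hc', P.step_of_speak hn, P.step_of_speak hn]
      have hs : P.send s (x' s) ((P.run x t).view s) = P.send s (x s) ((P.run x t).view s) := by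
        by_cases hsi : s = i
        · subst hsi
          rw [if_pos (Or.inl rfl)] at hc
          exact hc _ _ (List.prefix_refl _) rfl
        · rw [hx s hsi]
      rw [hs]

/-- The other sites can complete the view `v` of site `i`, and site `i` reports. -/
def CompletesSelf (i : Fin k) (v : Transcript k) (x : Fin k → X) : Prop :=
  ∃ a h, P.EndsAt (Function.update x i a) h i ∧ h.view i = v

/-- The other sites can complete the view `v` of site `i`, and one of them reports `o`. -/
def CompletesOther (i : Fin k) (v : Transcript k) (o : O) (x : Fin k → X) : Prop :=
  ∃ a h j, j ≠ i ∧ P.EndsAt (Function.update x i a) h j ∧ h.view i = v ∧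
    P.output j (x j) (h.view j) = o

variable {P}

theorem EndsAt.of_consistent {i j : Fin k} {x : Fin k → X} {a : X} {h : Transcript k}
    (H : P.EndsAt (Function.update x i a) h j) (hc : P.Consistent i (h.view i) (x i)) :
    P.EndsAt x h j := by
  obtain ⟨t, rfl, hj⟩ := H
  exact ⟨t, P.run_eq_of_consistent (fun l hl => by simp [hl]) t hc, hj⟩

theorem EndsAt.self_iff {i j : Fin k} {x : Fin k → X} {h : Transcript k} (H : P.EndsAt x h j)
    (v : Transcript k) :
    (P.Consistent i v (x i) ∧ P.CompletesSelf i v x) ↔ h.view i = v ∧ j = i := by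
  constructor
  · rintro ⟨hc, a, h', H', rfl⟩
    obtain ⟨rfl, rfl⟩ := H.unique (H'.of_consistent hc)
    exact ⟨rfl, rfl⟩
  · rintro ⟨rfl, rfl⟩
    refine ⟨?_, x j, h, by simpa using H, rfl⟩
    obtain ⟨t, rfl, -⟩ := H
    exact P.consistent_run _ _ _

theorem EndsAt.other_iff {i j : Fin k} {x : Fin k → X} {h : Transcript k} (H : P.EndsAt x h j)
    (v : Transcript k) (o : O) :
    (P.Consistent i v (x i) ∧ P.CompletesOther i v o x) ↔
      h.view i = v ∧ j ≠ i ∧ P.output j (x j) (h.view j) = o := by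
  constructor
  · rintro ⟨hc, a, h', j', hj', H', rfl, ho⟩
    obtain ⟨rfl, rfl⟩ := H.unique (H'.of_consistent hc)
    exact ⟨rfl, hj', ho⟩
  · rintro ⟨rfl, hj, ho⟩
    refine ⟨?_, x i, h, j, hj, by simpa using H, rfl, ho⟩
    obtain ⟨t, rfl, -⟩ := H
    exact P.consistent_run _ _ _

theorem completesSelf_congr {i : Fin k} {v : Transcript k} {x x' : Fin k → X}
    (hx : ∀ j, j ≠ i → x j = x' j) : P.CompletesSelf i v x ↔ P.CompletesSelf i v x' := by
  have : ∀ a, Function.update x i a = Function.update x' i a := by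
    intro a; funext j
    by_cases h : j = i
    · subst h; simp
    · simp [h, hx j h]
  simp only [CompletesSelf, this]

theorem completesOther_congr {i : Fin k} {v : Transcript k} {o : O} {x x' : Fin k → X}
    (hx : ∀ j, j ≠ i → x j = x' j) : P.CompletesOther i v o x ↔ P.CompletesOther i v o x' := by
  have : ∀ a, Function.update x i a = Function.update x' i a := by
    intro a; funext j
    by_cases h : j = i
    · subst h; simp
    · simp [h, hx j h]
  simp only [CompletesOther, this]
  refine exists_congr fun a => exists_congr fun h => exists_congr fun j => and_congr_right fun hj => ?_
  rw [hx j hj]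

open Classical in
/-- The event that site `i` has view `v` and the answer is `o` is a union of two disjoint
rectangles. -/
theorem EndsAt.rectangles {i j : Fin k} {x : Fin k → X} {h : Transcript k} (H : P.EndsAt x h j)
    (v : Transcript k) (o : O) :
    (if P.Consistent i v (x i) ∧ P.output i (x i) v = o then (1 : ℝ) else 0) *
        (if P.CompletesSelf i v x then 1 else 0) +
      (if P.Consistent i v (x i) then 1 else 0) * (if P.CompletesOther i v o x then 1 else 0) =
      if h.view i = v then (if P.output j (x j) (h.view j) = o then 1 else 0) else 0 := by
  have h1 := H.self_iff (i := i) v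
  have h2 := H.other_iff (i := i) v o
  by_cases hv : h.view i = v
  · by_cases hj : j = i
    · subst hj
      subst hv
      simp only [true_and, iff_true, ne_eq, not_true, false_and, iff_false] at h1 h2
      have h3 : ¬ P.CompletesOther j (h.view j) o x := fun hh => h2 ⟨h1.1, hh⟩
      simp [h1.1, h1.2, h3]
    · simp only [hv, hj, true_and, and_false, iff_false, ne_eq, not_false_iff] at h1 h2
      by_cases hc : P.Consistent i v (x i)
      · have : ¬ P.CompletesSelf i v x := fun hh => h1 ⟨hc, hh⟩
        simp only [hc, true_and] at h2
        simp [this, hc, hv, h2]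
      · have : ¬ P.output j (x j) (h.view j) = o := fun hh => hc (h2.2 hh).1
        simp [hc, this]
  · simp only [hv, false_and, iff_false] at h1 h2
    by_cases hc : P.Consistent i v (x i)
    · have h3 : ¬ P.CompletesSelf i v x := fun hh => h1 ⟨hc, hh⟩
      have h4 : ¬ P.CompletesOther i v o x := fun hh => h2 ⟨hc, hh⟩
      simp [hv, hc, h3, h4]
    · simp [hv, hc]

end DetProtocol

namespace Transcript

variable {k : ℕ}

theorem bits_cons (e : CommEvent k) (h : Transcript k) :
    bits (e :: h) = e.msg.1.length + bits h := by simp [bits]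

theorem one_le_length (w : BitMessage) : 1 ≤ w.1.length :=
  List.length_pos_iff.2 w.2

/-- Every bit of an event is counted in the views of at most two sites. -/
theorem sum_bits_view_le (h : Transcript k) : ∑ i, (h.view i).bits ≤ 2 * h.bits := by
  induction h with
  | nil => simp [view, bits]
  | cons e h ih =>
    have h1 : ∀ i, bits (view i (e :: h)) ≤
        ((if e.sender = i then e.msg.1.length else 0) +
          if e.receiver = i then e.msg.1.length else 0) + bits (view i h) := by
      intro i
      by_cases hs : e.sender = i <;> by_cases hr : e.receiver = i <;>
        simp [view, hs, hr, bits_cons]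
    refine (sum_le_sum fun i _ => h1 i).trans ?_
    rw [sum_add_distrib, sum_add_distrib, sum_ite_eq, sum_ite_eq, bits_cons]
    simp only [mem_univ, if_true]
    omega

/-- Extend a transcript by one bit at the front: a new event, or a longer first message. -/
def pushBit (c : (Fin k × Fin k) × Bool × Bool) : Transcript k → Transcript k
  | [] => [⟨c.1.1, c.1.2, [c.2.1], by simp⟩]
  | e :: h => if c.2.2 then ⟨c.1.1, c.1.2, [c.2.1], by simp⟩ :: e :: h
      else ⟨e.sender, e.receiver, c.2.1 :: e.msg.1, by simp⟩ :: h

open Classical in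
/-- A finite set that contains all transcripts with at most `b` bits. -/
noncomputable def shortSet (k : ℕ) : ℕ → Finset (Transcript k)
  | 0 => {[]}
  | b + 1 => insert [] ((univ ×ˢ shortSet k b).image fun p => pushBit p.1 p.2)

theorem mem_shortSet {b : ℕ} {h : Transcript k} (hb : h.bits ≤ b) : h ∈ shortSet k b := by
  induction b generalizing h with
  | zero =>
    cases h with
    | nil => simp [shortSet]
    | cons e h => have := one_le_length e.msg; rw [bits_cons] at hb; omega
  | succ b ih =>
    simp only [shortSet, mem_insert, mem_image, mem_product, mem_univ, true_and]
    cases h with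
    | nil => exact Or.inl rfl
    | cons e h =>
      right
      rw [bits_cons] at hb
      obtain ⟨s, r, ⟨w, hw⟩⟩ := e
      match w, hw with
      | [c], _ =>
        refine ⟨(((s, r), c, true), h), ih (h := h) (by simp at hb; omega), ?_⟩
        cases h <;> simp [pushBit]
      | c :: c' :: w, _ =>
        refine ⟨(((s, r), c, false), ⟨s, r, c' :: w, by simp⟩ :: h), ih ?_, by simp [pushBit]⟩
        rw [bits_cons]; simp at hb ⊢; omega

open Classical in
theorem card_shortSet_le (k b : ℕ) : #(shortSet k b) ≤ (4 * k ^ 2 + 1) ^ b := by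
  induction b with
  | zero => simp [shortSet]
  | succ b ih =>
    refine (card_insert_le _ _).trans ?_
    have h1 : #((univ ×ˢ shortSet k b).image fun p : ((Fin k × Fin k) × Bool × Bool) × _ =>
        pushBit p.1 p.2) ≤ 4 * k ^ 2 * #(shortSet k b) := by
      refine card_image_le.trans ?_
      rw [card_product]
      simp only [card_univ, Fintype.card_prod, Fintype.card_fin, Fintype.card_bool]
      exact le_of_eq (by ring)
    have h2 : 1 ≤ (4 * k ^ 2 + 1) ^ b := Nat.one_le_pow _ _ (by omega)
    have h3 := Nat.mul_le_mul_left (4 * k ^ 2) ih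
    rw [pow_succ]
    nlinarith

end Transcript

namespace SimpleGraph

/-- A graph in which each vertex has at most one smaller neighbour has no cycle. -/
theorem isAcyclic_of_unique_lower {V : Type*} [LinearOrder V] {G : SimpleGraph V}
    (h : ∀ u v w, G.Adj w u → G.Adj w v → u < w → v < w → u = v) : G.IsAcyclic := by
  intro r c hc
  obtain ⟨w, hw, hmax⟩ := c.support.toFinset.exists_max_image id ⟨r, by simp⟩
  simp only [List.mem_toFinset, id] at hw hmax
  have hc' := hc.rotate hw
  have hlt : ∀ z ∈ (c.rotate w hw).support, G.Adj w z → z < w := fun z hz ha =>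
    lt_of_le_of_ne (hmax z (by simpa using hz)) ha.ne'
  have h1 := (c.rotate w hw).adj_snd hc'.not_nil
  have h2 := ((c.rotate w hw).adj_penultimate hc'.not_nil).symm
  exact hc'.snd_ne_penultimate (h _ _ _ h1 h2 (hlt _ (Walk.getVert_mem_support _ _) h1)
    (hlt _ (Walk.getVert_mem_support _ _) h2))

end SimpleGraph

section Stars

variable {n N : ℕ}

/-- The graph that joins the vertex `c` to the vertices `j + 2` with `a j`. -/
def starOn (c : ℕ) (a : Fin N → Bool) : SimpleGraph (Fin n) :=
  SimpleGraph.fromRel fun u v => u.val = c ∧ ∃ j, a j = true ∧ v.val = j.val + 2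

/-- The local graph of the first site: a star at vertex one and the edge between zero and one. -/
def rootGraph (y : Fin N → Bool) : SimpleGraph (Fin n) :=
  starOn 1 y ⊔ SimpleGraph.fromRel fun u v => u.val = 0 ∧ v.val = 1

/-- The local graphs that encode the sets `y` and `z i`. -/
def starInput {K : ℕ} (n : ℕ) (y : Fin N → Bool) (z : Fin K → Fin N → Bool) :
    Fin (K + 1) → SimpleGraph (Fin n) :=
  Fin.cons (rootGraph y) fun i => starOn 0 (z i)

theorem unionGraph_starInput_adj {K : ℕ} {y : Fin N → Bool} {z : Fin K → Fin N → Bool}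
    {u v : Fin n} (h : (unionGraph (starInput n y z)).Adj u v) (huv : v < u) :
    (v.val = 0 ∧ ∃ i j, z i j = true ∧ u.val = j.val + 2) ∨
    (v.val = 1 ∧ ∃ j, y j = true ∧ u.val = j.val + 2) ∨ (v.val = 0 ∧ u.val = 1) := by
  have huv' : v.val < u.val := huv
  simp only [unionGraph, SimpleGraph.iSup_adj, Fin.exists_fin_succ, starInput, Fin.cons_zero,
    Fin.cons_succ, rootGraph, starOn, SimpleGraph.sup_adj, SimpleGraph.fromRel_adj] at h
  rcases h with (⟨-, ⟨h, j, hj, h'⟩ | ⟨h, j, hj, h'⟩⟩ | ⟨-, ⟨h, h'⟩ | ⟨h, h'⟩⟩) |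
    ⟨i, -, ⟨h, j, hj, h'⟩ | ⟨h, j, hj, h'⟩⟩
  · omega
  · exact Or.inr (Or.inl ⟨h, j, hj, h'⟩)
  · omega
  · exact Or.inr (Or.inr ⟨h, h'⟩)
  · omega
  · exact Or.inl ⟨h, i, j, hj, h'⟩

theorem isAcyclic_starInput {K : ℕ} {y : Fin N → Bool} {z : Fin K → Fin N → Bool}
    (h : ∀ i j, ¬ (z i j = true ∧ y j = true)) : (unionGraph (starInput n y z)).IsAcyclic := by
  refine SimpleGraph.isAcyclic_of_unique_lower fun u v w hu hv huw hvw => ?_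
  rcases unionGraph_starInput_adj hu huw with ⟨h1, i, j, hj, h2⟩ | ⟨h1, j, hj, h2⟩ | ⟨h1, h2⟩ <;>
  rcases unionGraph_starInput_adj hv hvw with ⟨h1', i', j', hj', h2'⟩ | ⟨h1', j', hj', h2'⟩ |
    ⟨h1', h2'⟩ <;> first
      | (apply Fin.ext; omega)
      | (obtain rfl : j = j' := Fin.ext (by omega)
         first | exact absurd ⟨hj, hj'⟩ (h _ _) | exact absurd ⟨hj', hj⟩ (h _ _))

theorem not_isAcyclic_starInput {K : ℕ} {y : Fin N → Bool} {z : Fin K → Fin N → Bool}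
    (hn : N + 2 ≤ n) {i : Fin K} {j : Fin N} (hz : z i j = true) (hy : y j = true) :
    ¬ (unionGraph (starInput n y z)).IsAcyclic := by
  intro hac
  have hj := j.isLt
  let a : Fin n := ⟨0, by omega⟩
  let b : Fin n := ⟨1, by omega⟩
  let c : Fin n := ⟨j.val + 2, by omega⟩
  refine hac.cliqueFree le_rfl {a, b, c} (SimpleGraph.is3Clique_triple_iff.2 ⟨?_, ?_, ?_⟩) <;>
  simp only [unionGraph, SimpleGraph.iSup_adj, Fin.exists_fin_succ, starInput, Fin.cons_zero,
    Fin.cons_succ, rootGraph, starOn, SimpleGraph.sup_adj, SimpleGraph.fromRel_adj]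
  · exact Or.inl (Or.inr ⟨by simp [a, b], Or.inl ⟨rfl, rfl⟩⟩)
  · exact Or.inr ⟨i, by simp [a, c], Or.inl ⟨rfl, j, hz, rfl⟩⟩
  · exact Or.inl (Or.inl ⟨by simp [b, c], Or.inl ⟨rfl, j, hy, rfl⟩⟩)

theorem starInput_mem {K m : ℕ} (hn : N + 2 ≤ n) (hm : 2 * N + 1 ≤ m) (y : Fin N → Bool)
    (z : Fin K → Fin N → Bool) : starInput n y z ∈ duplicationInputs (K + 1) n m := by
  classical
  let a : Fin n := ⟨0, by omega⟩
  let b : Fin n := ⟨1, by omega⟩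
  let c : Fin N → Fin n := fun j => ⟨j.val + 2, by omega⟩
  let T : Finset (Sym2 (Fin n)) :=
    (univ.image fun j => s(a, c j)) ∪ (univ.image fun j => s(b, c j)) ∪ {s(a, b)}
  have hT : #T ≤ 2 * N + 1 := by
    refine (card_union_le _ _).trans (add_le_add ((card_union_le _ _).trans ?_) (by simp))
    have h1 : #(univ.image fun j => s(a, c j)) ≤ N := card_image_le.trans (by simp)
    have h2 : #(univ.image fun j => s(b, c j)) ≤ N := card_image_le.trans (by simp)
    omega
  have hlow : ∀ u v : Fin n, (unionGraph (starInput n y z)).Adj u v → v < u → s(v, u) ∈ T := by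
    intro u v h huv
    simp only [T, mem_union, mem_image, mem_univ, true_and, mem_singleton]
    rcases unionGraph_starInput_adj h huv with ⟨h1, i, j, -, h2⟩ | ⟨h1, j, -, h2⟩ | ⟨h1, h2⟩
    · obtain rfl : v = a := Fin.ext h1
      obtain rfl : u = c j := Fin.ext h2
      exact Or.inl (Or.inl ⟨j, rfl⟩)
    · obtain rfl : v = b := Fin.ext h1
      obtain rfl : u = c j := Fin.ext h2
      exact Or.inl (Or.inr ⟨j, rfl⟩)
    · obtain rfl : v = a := Fin.ext h1
      obtain rfl : u = b := Fin.ext h2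
      exact Or.inr rfl
  have hsub : (unionGraph (starInput n y z)).edgeSet ⊆ (T : Set (Sym2 (Fin n))) := by
    intro e
    induction e with
    | _ u v =>
      intro h
      rw [SimpleGraph.mem_edgeSet] at h
      rcases lt_or_gt_of_ne h.ne with huv | huv
      · exact hlow v u h.symm huv
      · rw [Sym2.eq_swap]; exact hlow u v h huv
  refine (Set.ncard_le_ncard hsub (finite_toSet T)).trans ?_
  rw [Set.ncard_coe_finset]
  omega

end Stars

section Law

variable {Θ Z : Type*} [Fintype Θ] [DecidableEq Z]

/-- The probability of `z` under the image of the uniform distribution under `φ`. -/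
noncomputable def mapWeight (φ : Θ → Z) (z : Z) : ℝ := avg fun θ => if φ θ = z then 1 else 0

theorem mapWeight_nonneg (φ : Θ → Z) (z : Z) : 0 ≤ mapWeight φ z :=
  avg_nonneg fun θ => by split_ifs <;> norm_num

theorem exists_of_mapWeight_ne_zero {φ : Θ → Z} {z : Z} (h : mapWeight φ z ≠ 0) :
    ∃ θ, φ θ = z := by
  by_contra! hne
  exact h (by simp [mapWeight, avg, hne])

theorem mapWeight_pos (φ : Θ → Z) (θ : Θ) : 0 < mapWeight φ (φ θ) := by
  have : Nonempty Θ := ⟨θ⟩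
  refine mul_pos (by positivity) (sum_pos' (fun θ' _ => by split_ifs <;> norm_num)
    ⟨θ, mem_univ _, by simp⟩)

theorem sum_mapWeight_mul [Fintype Z] (φ : Θ → Z) (F : Z → ℝ) :
    ∑ z, mapWeight φ z * F z = avg fun θ => F (φ θ) := by
  simp only [mapWeight, ← avg_mul_const]
  rw [← avg_sum]
  simp

end Law

section Lift

variable {A : Type*} {K : ℕ}

/-- The weight of `(y, z)` when `(z i, y)` has the joint weight `p` and the other entries of `z`
are drawn independently from `κ y`. -/
noncomputable def liftWeight (κ p : A → A → ℝ) (i : Fin K) (y : A) (z : Fin K → A) : ℝ :=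
  p (z i) y * ∏ j ∈ univ.erase i, κ y (z j)

theorem liftWeight_nonneg {κ p : A → A → ℝ} (hκ : ∀ y a, 0 ≤ κ y a) (hp : ∀ a y, 0 ≤ p a y)
    (i : Fin K) (y : A) (z : Fin K → A) : 0 ≤ liftWeight κ p i y z :=
  mul_nonneg (hp _ _) (prod_nonneg fun _ _ => hκ _ _)

theorem liftWeight_eq_of_marginal {κ p : A → A → ℝ} {q : A → ℝ} (h : ∀ a y, p a y = q y * κ y a)
    (i : Fin K) (y : A) (z : Fin K → A) : liftWeight κ p i y z = q y * ∏ j, κ y (z j) := by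
  rw [liftWeight, h, mul_assoc, mul_prod_erase univ (fun j => κ y (z j)) (mem_univ i)]

variable [Fintype A]

theorem sum_mul_of_update [DecidableEq A] [Nonempty A] (i : Fin K) (φ : A → ℝ)
    {ψ : (Fin K → A) → ℝ} (hψ : ∀ z a, ψ (Function.update z i a) = ψ z) :
    ∑ z, φ (z i) * ψ z = (∑ a, φ a) * ((Fintype.card A : ℝ)⁻¹ * ∑ z, ψ z) := by
  let e := Equiv.funSplitAt i A
  let a₀ : A := Classical.arbitrary A
  have hi : ∀ p, (e.symm p) i = p.1 := fun p => by simp [e, Equiv.funSplitAt, Equiv.piSplitAt]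
  have hup : ∀ a r, e.symm (a, r) = Function.update (e.symm (a₀, r)) i a := by
    intro a r; funext j
    by_cases h : j = i
    · subst h; simp [e, Equiv.funSplitAt, Equiv.piSplitAt]
    · simp [e, Equiv.funSplitAt, Equiv.piSplitAt, h]
  have hs : ∀ a r, ψ (e.symm (a, r)) = ψ (e.symm (a₀, r)) := fun a r => by rw [hup, hψ]
  rw [← Equiv.sum_comp e.symm, ← Equiv.sum_comp e.symm (fun z => ψ z), Fintype.sum_prod_type,
    Fintype.sum_prod_type]
  simp only [hi, hs, ← mul_sum, ← sum_mul, sum_const, card_univ, nsmul_eq_mul]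
  field_simp

theorem sum_prod_eq_one {κ : A → ℝ} (h1 : ∑ a, κ a = 1) : ∑ z : Fin K → A, ∏ j, κ (z j) = 1 := by
  classical
  have := Finset.prod_univ_sum (fun _ : Fin K => (univ : Finset A)) fun _ a => κ a
  rw [Fintype.piFinset_univ] at this
  rw [← this, h1]; simp

theorem liftWeight_rect [Nonempty A] {κ : A → A → ℝ} (hκ : ∀ y a, 0 ≤ κ y a)
    (hκ1 : ∀ y, ∑ a, κ y a = 1) (i : Fin K) {g : A → (Fin K → A) → ℝ} (hg0 : ∀ y z, 0 ≤ g y z)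
    (hg1 : ∀ y z, g y z ≤ 1) (hg : ∀ y z a, g y (Function.update z i a) = g y z) :
    ∃ G : A → ℝ, (∀ y, 0 ≤ G y) ∧ (∀ y, G y ≤ 1) ∧ ∀ (p : A → A → ℝ) (f : A → ℝ),
      ∑ y, ∑ z, liftWeight κ p i y z * (f (z i) * g y z) =
        ∑ y, ∑ a, p a y * (f a * G y) := by
  classical
  have hprod : ∀ y z a, ∏ j ∈ univ.erase i, κ y (Function.update z i a j) =
      ∏ j ∈ univ.erase i, κ y (z j) := fun y z a =>
    prod_congr rfl fun j hj => by rw [Function.update_of_ne (ne_of_mem_erase hj)]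
  refine ⟨fun y => (Fintype.card A : ℝ)⁻¹ * ∑ z, (∏ j ∈ univ.erase i, κ y (z j)) * g y z,
    fun y => mul_nonneg (by positivity) (sum_nonneg fun z _ =>
      mul_nonneg (prod_nonneg fun _ _ => hκ _ _) (hg0 _ _)), fun y => ?_, fun p f => ?_⟩
  · have h := sum_mul_of_update i (κ y) (ψ := fun z => ∏ j ∈ univ.erase i, κ y (z j)) (hprod y)
    have h2 : ∀ z : Fin K → A, κ y (z i) * ∏ j ∈ univ.erase i, κ y (z j) = ∏ j, κ y (z j) :=
      fun z => mul_prod_erase univ (fun j => κ y (z j)) (mem_univ i)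
    simp only [h2, sum_prod_eq_one (hκ1 y), hκ1, one_mul] at h
    rw [h]
    exact mul_le_mul_of_nonneg_left (sum_le_sum fun z _ => mul_le_of_le_one_right
      (prod_nonneg fun _ _ => hκ _ _) (hg1 _ _)) (by positivity)
  · refine sum_congr rfl fun y _ => ?_
    have h := sum_mul_of_update i (fun a => p a y * f a)
      (ψ := fun z => (∏ j ∈ univ.erase i, κ y (z j)) * g y z)
      (fun z a => by rw [hprod, hg])
    calc _ = ∑ z : Fin K → A, p (z i) y * f (z i) *
          ((∏ j ∈ univ.erase i, κ y (z j)) * g y z) :=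
          sum_congr rfl fun z _ => by rw [liftWeight]; ring
      _ = _ := by
          rw [h, sum_mul]
          exact sum_congr rfl fun a _ => by ring

end Lift

section PairLaws

variable {ι : Type*} [Fintype ι] [DecidableEq ι]

/-- A random pair of disjoint sets. -/
def disjointPair (θ : (ι → Bool) × (ι → Bool) × (ι → Bool)) : (ι → Bool) × (ι → Bool) :=
  (mask θ.1 θ.2.1, mask (neg θ.1) θ.2.2)

/-- A random pair of sets that meet in the element `θ.1`. -/
def meetingPair (θ : ι × (ι → Bool) × (ι → Bool) × (ι → Bool)) : (ι → Bool) × (ι → Bool) :=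
  (Function.update (mask θ.2.1 θ.2.2.1) θ.1 true,
    Function.update (mask (neg θ.2.1) θ.2.2.2) θ.1 true)

/-- The distribution on disjoint pairs. -/
noncomputable def disjointLaw (a y : ι → Bool) : ℝ := mapWeight disjointPair (a, y)

/-- The distribution on pairs that meet. -/
noncomputable def meetingLaw (a y : ι → Bool) : ℝ := mapWeight meetingPair (a, y)

theorem sum_disjointLaw (f g : (ι → Bool) → ℝ) :
    ∑ y, ∑ a, disjointLaw a y * (f a * g y) = avg fun d => maskAvg f d * maskAvg g (neg d) := by
  rw [sum_comm]
  have h := sum_mapWeight_mul (disjointPair (ι := ι)) fun q => f q.1 * g q.2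
  rw [Fintype.sum_prod_type] at h
  refine h.trans ?_
  simp only [disjointPair]
  rw [avg_prod fun (d : ι → Bool) (p : (ι → Bool) × (ι → Bool)) =>
    f (mask d p.1) * g (mask (neg d) p.2)]
  congr 1; funext d
  rw [avg_prod fun (w w' : ι → Bool) => f (mask d w) * g (mask (neg d) w')]
  simp only [avg_const_mul, avg_mul_const]
  rfl

theorem sum_meetingLaw (f g : (ι → Bool) → ℝ) :
    ∑ y, ∑ a, meetingLaw a y * (f a * g y) = (Fintype.card ι : ℝ)⁻¹ *
      ∑ j, avg fun d => maskAvgOne f d j * maskAvgOne g (neg d) j := by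
  rw [sum_comm]
  have h := sum_mapWeight_mul (meetingPair (ι := ι)) fun q => f q.1 * g q.2
  rw [Fintype.sum_prod_type] at h
  refine h.trans ?_
  simp only [meetingPair]
  rw [avg_prod fun (j : ι) (p : (ι → Bool) × (ι → Bool) × (ι → Bool)) =>
    f (Function.update (mask p.1 p.2.1) j true) *
      g (Function.update (mask (neg p.1) p.2.2) j true)]
  rw [avg]
  congr 1
  refine sum_congr rfl fun j _ => ?_
  rw [avg_prod fun (d : ι → Bool) (p : (ι → Bool) × (ι → Bool)) =>
    f (Function.update (mask d p.1) j true) * g (Function.update (mask (neg d) p.2) j true)]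
  congr 1; funext d
  rw [avg_prod fun (w w' : ι → Bool) => f (Function.update (mask d w) j true) *
    g (Function.update (mask (neg d) w') j true)]
  simp only [avg_const_mul, avg_mul_const]
  rfl

theorem disjoint_of_disjointLaw_ne_zero {a y : ι → Bool} (h : disjointLaw a y ≠ 0) (j : ι) :
    ¬ (a j = true ∧ y j = true) := by
  obtain ⟨⟨d, w, w'⟩, hθ⟩ := exists_of_mapWeight_ne_zero h
  simp only [disjointPair, Prod.mk.injEq] at hθ
  rw [← hθ.1, ← hθ.2]
  cases hd : d j <;> simp [mask, neg, hd]

theorem exists_of_meetingLaw_ne_zero {a y : ι → Bool} (h : meetingLaw a y ≠ 0) :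
    ∃ j, a j = true ∧ y j = true := by
  obtain ⟨⟨j, d, w, w'⟩, hθ⟩ := exists_of_mapWeight_ne_zero h
  simp only [meetingPair, Prod.mk.injEq] at hθ
  exact ⟨j, by rw [← hθ.1]; simp, by rw [← hθ.2]; simp⟩

/-- The error term of the corruption bound. -/
noncomputable def corruptionError (N : ℕ) : ℝ := 1000 / N * Real.exp (-(N / 20000))

theorem meetingLaw_rect_ge [Nonempty ι] {f g : (ι → Bool) → ℝ} (hf0 : ∀ x, 0 ≤ f x)
    (hf1 : ∀ x, f x ≤ 1) (hg0 : ∀ x, 0 ≤ g x) (hg1 : ∀ x, g x ≤ 1) :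
    9 / 10 * ∑ y, ∑ a, disjointLaw a y * (f a * g y) - corruptionError (Fintype.card ι) ≤
      ∑ y, ∑ a, meetingLaw a y * (f a * g y) := by
  have h := corruption hf0 hf1 hg0 hg1 (t := 1 / 100) (by norm_num)
  rw [sum_disjointLaw, sum_meetingLaw, corruptionError]
  have hN : (0 : ℝ) < Fintype.card ι := by exact_mod_cast Fintype.card_pos
  have h2 := mul_le_mul_of_nonneg_left h (inv_pos.2 hN).le
  refine le_trans (le_of_eq ?_) h2
  have : (1 / 100 : ℝ) ^ 2 * (Fintype.card ι) / 2 = Fintype.card ι / 20000 := by ring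
  rw [this]
  field_simp
  ring

/-- The second marginal of `disjointLaw`. -/
noncomputable def disjointMarginal (y : ι → Bool) : ℝ := ∑ a, disjointLaw a y

/-- The conditional distribution of the first set given the second. -/
noncomputable def disjointCond (y a : ι → Bool) : ℝ := disjointLaw a y / disjointMarginal y

theorem disjointMarginal_pos (y : ι → Bool) : 0 < disjointMarginal y := by
  refine sum_pos' (fun a _ => mapWeight_nonneg _ _) ⟨fun _ => false, mem_univ _, ?_⟩
  have := mapWeight_pos disjointPair ((fun _ => false, fun _ => false, y) :
    (ι → Bool) × (ι → Bool) × (ι → Bool))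
  have e : disjointPair ((fun _ => false, fun _ => false, y) :
      (ι → Bool) × (ι → Bool) × (ι → Bool)) = (fun _ => false, y) := by
    simp [disjointPair, mask, neg, funext_iff]
  rwa [e] at this

theorem disjointCond_nonneg (y a : ι → Bool) : 0 ≤ disjointCond y a :=
  div_nonneg (mapWeight_nonneg _ _) (disjointMarginal_pos y).le

theorem sum_disjointCond (y : ι → Bool) : ∑ a, disjointCond y a = 1 := by
  simp only [disjointCond, ← sum_div]
  exact div_self (disjointMarginal_pos y).ne'

theorem disjointLaw_eq (a y : ι → Bool) :
    disjointLaw a y = disjointMarginal y * disjointCond y a := by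
  rw [disjointCond, mul_div_cancel₀ _ (disjointMarginal_pos y).ne']

theorem sum_disjointMarginal : ∑ y : ι → Bool, disjointMarginal y = 1 := by
  have h := sum_disjointLaw (ι := ι) (fun _ => 1) fun _ => 1
  simp only [maskAvg, avg_const, mul_one] at h
  exact h

theorem sum_meetingLaw_one [Nonempty ι] : ∑ y, ∑ a : ι → Bool, meetingLaw a y = 1 := by
  have h := sum_meetingLaw (ι := ι) (fun _ => 1) fun _ => 1
  simp only [maskAvgOne, avg_const, mul_one, sum_const, card_univ, nsmul_eq_mul] at h
  rwa [inv_mul_cancel₀ (by positivity)] at h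

end PairLaws

section Averaging

open MeasureTheory

/-- If each of finitely many events has outer probability at most `δ`, then a weighted count of
them cannot exceed `δ` times the total weight everywhere. -/
theorem le_of_forall_le_sum_indicator {Ω Z : Type*} [MeasurableSpace Ω] {μ : Measure Ω}
    [IsProbabilityMeasure μ] [Fintype Z] {c : Z → ℝ} (hc : ∀ z, 0 ≤ c z) {bad : Z → Set Ω}
    {δ : ℝ} (hδ : 0 ≤ δ) (hbad : ∀ z, μ (bad z) ≤ ENNReal.ofReal δ) {s : ℝ}
    (hs : ∀ ω, s ≤ ∑ z, c z * (bad z).indicator 1 ω) : s ≤ (∑ z, c z) * δ := by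
  let B : Z → Set Ω := fun z => toMeasurable μ (bad z)
  have hB : ∀ z, MeasurableSet (B z) := fun z => measurableSet_toMeasurable _ _
  have hint : ∀ z, Integrable ((B z).indicator (1 : Ω → ℝ)) μ := fun z =>
    (integrable_const (1 : ℝ)).indicator (hB z)
  calc s = ∫ _, s ∂μ := by simp
    _ ≤ ∫ ω, ∑ z, c z * (B z).indicator (1 : Ω → ℝ) ω ∂μ := by
        refine integral_mono (integrable_const _)
          (integrable_finsetSum _ fun z _ => (hint z).const_mul _) fun ω => (hs ω).trans ?_
        exact sum_le_sum fun z _ => mul_le_mul_of_nonneg_left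
          (Set.indicator_le_indicator_of_subset (subset_toMeasurable _ _)
            (fun _ => zero_le_one) ω) (hc z)
    _ = ∑ z, c z * μ.real (B z) := by
        rw [integral_finsetSum _ fun z _ => (hint z).const_mul _]
        refine sum_congr rfl fun z _ => ?_
        rw [integral_const_mul, integral_indicator_one (hB z)]
    _ ≤ ∑ z, c z * δ := by
        refine sum_le_sum fun z _ => mul_le_mul_of_nonneg_left ?_ (hc z)
        refine ENNReal.toReal_le_of_le_ofReal hδ ?_
        rw [measure_toMeasurable]
        exact hbad z
    _ = _ := by rw [sum_mul]

end Averaging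

theorem sum_rotate {α β γ : Type*} [Fintype α] [Fintype β] (S : Finset γ) (F : α → β → γ → ℝ) :
    ∑ y, ∑ z, ∑ v ∈ S, F y z v = ∑ v ∈ S, ∑ y, ∑ z, F y z v := by
  rw [sum_comm (s := S)]
  exact sum_congr rfl fun y _ => sum_comm

section StarBound

variable {N K n : ℕ}

/-- The probability of the sets `y` and `z i` when the `z i` are disjoint from `y` and independent
given `y`. -/
noncomputable def disjointWeight (y : Fin N → Bool) (z : Fin K → Fin N → Bool) : ℝ :=
  disjointMarginal y * ∏ j, disjointCond y (z j)

theorem disjointWeight_nonneg (y : Fin N → Bool) (z : Fin K → Fin N → Bool) :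
    0 ≤ disjointWeight y z :=
  mul_nonneg (disjointMarginal_pos y).le (prod_nonneg fun _ _ => disjointCond_nonneg _ _)

theorem sum_disjointWeight :
    ∑ y : Fin N → Bool, ∑ z : Fin K → Fin N → Bool, disjointWeight y z = 1 := by
  simp only [disjointWeight, ← mul_sum, sum_prod_eq_one (sum_disjointCond _), mul_one,
    sum_disjointMarginal]

theorem liftWeight_disjointLaw (i : Fin K) (y : Fin N → Bool) (z : Fin K → Fin N → Bool) :
    liftWeight disjointCond disjointLaw i y z = disjointWeight y z :=
  liftWeight_eq_of_marginal disjointLaw_eq i y z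

/-- The probability of the sets `y` and `z i` when exactly the set `z i` meets `y`. -/
noncomputable def meetingWeight (i : Fin K) (y : Fin N → Bool) (z : Fin K → Fin N → Bool) : ℝ :=
  liftWeight disjointCond meetingLaw i y z

theorem meetingWeight_nonneg (i : Fin K) (y : Fin N → Bool) (z : Fin K → Fin N → Bool) :
    0 ≤ meetingWeight i y z :=
  liftWeight_nonneg disjointCond_nonneg (fun _ _ => mapWeight_nonneg _ _) i y z

theorem sum_meetingWeight_le [NeZero N] (i : Fin K) :
    ∑ y : Fin N → Bool, ∑ z : Fin K → Fin N → Bool, meetingWeight i y z ≤ 1 := by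
  obtain ⟨G, hG0, hG1, hG⟩ := liftWeight_rect (A := Fin N → Bool) disjointCond_nonneg
    sum_disjointCond i (g := fun _ _ => 1) (fun _ _ => zero_le_one) (fun _ _ => le_rfl)
    fun _ _ _ => rfl
  have h := hG meetingLaw fun _ => 1
  simp only [mul_one, one_mul] at h
  refine (le_of_eq h).trans ((sum_le_sum fun y _ => sum_le_sum fun a _ =>
    mul_le_of_le_one_right (mapWeight_nonneg _ _) (hG1 y)).trans ?_)
  exact le_of_eq sum_meetingLaw_one

theorem meetingWeight_rect_ge [NeZero N] (i : Fin K) {f : (Fin N → Bool) → ℝ}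
    (hf0 : ∀ a, 0 ≤ f a) (hf1 : ∀ a, f a ≤ 1) {g : (Fin N → Bool) → (Fin K → Fin N → Bool) → ℝ}
    (hg0 : ∀ y z, 0 ≤ g y z) (hg1 : ∀ y z, g y z ≤ 1)
    (hg : ∀ y z a, g y (Function.update z i a) = g y z) :
    9 / 10 * (∑ y, ∑ z, disjointWeight y z * (f (z i) * g y z)) - corruptionError N ≤
      ∑ y, ∑ z, meetingWeight i y z * (f (z i) * g y z) := by
  obtain ⟨G, hG0, hG1, hG⟩ := liftWeight_rect (A := Fin N → Bool) disjointCond_nonneg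
    sum_disjointCond i hg0 hg1 hg
  have h1 := hG disjointLaw f
  have h2 := hG meetingLaw f
  simp only [liftWeight_disjointLaw] at h1
  have h := meetingLaw_rect_ge hf0 hf1 hG0 hG1
  rw [Fintype.card_fin] at h
  simp only [meetingWeight]
  rw [h1, h2]
  exact h

theorem starInput_update_off (y : Fin N → Bool) (z : Fin K → Fin N → Bool) (i : Fin K)
    (a : Fin N → Bool) (j : Fin (K + 1)) (hj : j ≠ i.succ) :
    starInput n y (Function.update z i a) j = starInput n y z j := by
  induction j using Fin.cases with
  | zero => rfl
  | succ l =>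
    simp only [starInput, Fin.cons_succ]
    rw [Function.update_of_ne fun h => hj (by rw [h])]

open Classical in
/-- The probability that the answer is `true` and the view of a site is short hardly decreases
when the set of this site is made to meet `y`. -/
theorem meetingWeight_short_ge [NeZero N] (P : DetProtocol (K + 1) (SimpleGraph (Fin n)) Bool)
    {h : (Fin N → Bool) → (Fin K → Fin N → Bool) → Transcript (K + 1)}
    {r : (Fin N → Bool) → (Fin K → Fin N → Bool) → Fin (K + 1)}
    (hr : ∀ y z, P.EndsAt (starInput n y z) (h y z) (r y z)) (S : Finset (Transcript (K + 1)))
    (i : Fin K) {F : (Fin N → Bool) → (Fin K → Fin N → Bool) → ℝ}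
    (hF : ∀ y z, F y z = if (h y z).view i.succ ∈ S then
      (if P.output (r y z) (starInput n y z (r y z)) ((h y z).view (r y z)) = true
        then 1 else 0) else 0) :
    9 / 10 * (∑ y, ∑ z, disjointWeight y z * F y z) - 2 * #S * corruptionError N ≤
      ∑ y, ∑ z, meetingWeight i y z * F y z := by
  let f₁ : Transcript (K + 1) → (Fin N → Bool) → ℝ := fun v a =>
    if P.Consistent i.succ v (starOn 0 a) ∧ P.output i.succ (starOn 0 a) v = true then 1 else 0
  let f₂ : Transcript (K + 1) → (Fin N → Bool) → ℝ := fun v a =>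
    if P.Consistent i.succ v (starOn 0 a) then 1 else 0
  let g₁ : Transcript (K + 1) → (Fin N → Bool) → (Fin K → Fin N → Bool) → ℝ := fun v y z =>
    if P.CompletesSelf i.succ v (starInput n y z) then 1 else 0
  let g₂ : Transcript (K + 1) → (Fin N → Bool) → (Fin K → Fin N → Bool) → ℝ := fun v y z =>
    if P.CompletesOther i.succ v true (starInput n y z) then 1 else 0
  have hsum : ∀ y z, F y z = ∑ v ∈ S, (f₁ v (z i) * g₁ v y z + f₂ v (z i) * g₂ v y z) := by
    intro y z
    rw [hF]
    refine (sum_ite_eq S ((h y z).view i.succ) fun _ => if P.output (r y z)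
      (starInput n y z (r y z)) ((h y z).view (r y z)) = true then (1 : ℝ) else 0).symm.trans ?_
    refine sum_congr rfl fun v _ => ?_
    convert ((hr y z).rectangles (i := i.succ) v true).symm <;> rfl
  have expand : ∀ w : (Fin N → Bool) → (Fin K → Fin N → Bool) → ℝ,
      ∑ y, ∑ z, w y z * F y z = ∑ v ∈ S, (∑ y, ∑ z, w y z * (f₁ v (z i) * g₁ v y z) +
        ∑ y, ∑ z, w y z * (f₂ v (z i) * g₂ v y z)) := by
    intro w
    simp only [hsum, mul_sum, mul_add, ← sum_add_distrib]
    rw [sum_rotate]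
  rw [expand, expand]
  have h1 : ∀ v, 9 / 10 * (∑ y, ∑ z, disjointWeight y z * (f₁ v (z i) * g₁ v y z)) -
      corruptionError N ≤ ∑ y, ∑ z, meetingWeight i y z * (f₁ v (z i) * g₁ v y z) := by
    intro v
    refine meetingWeight_rect_ge i ?_ ?_ ?_ ?_ fun y z a => ?_
    iterate 2 intro a; simp only [f₁]; split_ifs <;> norm_num
    iterate 2 intro y z; simp only [g₁]; split_ifs <;> norm_num
    simp only [g₁, DetProtocol.completesSelf_congr (starInput_update_off y z i a)]
  have h2 : ∀ v, 9 / 10 * (∑ y, ∑ z, disjointWeight y z * (f₂ v (z i) * g₂ v y z)) -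
      corruptionError N ≤ ∑ y, ∑ z, meetingWeight i y z * (f₂ v (z i) * g₂ v y z) := by
    intro v
    refine meetingWeight_rect_ge i ?_ ?_ ?_ ?_ fun y z a => ?_
    iterate 2 intro a; simp only [f₂]; split_ifs <;> norm_num
    iterate 2 intro y z; simp only [g₂]; split_ifs <;> norm_num
    simp only [g₂, DetProtocol.completesOther_congr (starInput_update_off y z i a)]
  calc _ = ∑ v ∈ S, (9 / 10 * (∑ y, ∑ z, disjointWeight y z * (f₁ v (z i) * g₁ v y z)) -
      corruptionError N + (9 / 10 * (∑ y, ∑ z, disjointWeight y z * (f₂ v (z i) * g₂ v y z)) -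
      corruptionError N)) := by
        simp only [sum_add_distrib, sum_sub_distrib, sum_const, nsmul_eq_mul, mul_add, ← mul_sum]
        ring
    _ ≤ _ := sum_le_sum fun v _ => add_le_add (h1 v) (h2 v)

theorem cycleFreeness_of_disjointWeight_ne_zero {y : Fin N → Bool} {z : Fin K → Fin N → Bool}
    (h : disjointWeight y z ≠ 0) : cycleFreeness (starInput n y z) = true := by
  classical
  rw [cycleFreeness, decide_eq_true_iff]
  refine isAcyclic_starInput fun i => disjoint_of_disjointLaw_ne_zero ?_
  rw [disjointLaw_eq]
  exact mul_ne_zero (disjointMarginal_pos y).ne' (prod_ne_zero_iff.1 (right_ne_zero_of_mul h) i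
    (mem_univ i))

theorem cycleFreeness_of_meetingWeight_ne_zero (hn : N + 2 ≤ n) {i : Fin K} {y : Fin N → Bool}
    {z : Fin K → Fin N → Bool} (h : meetingWeight i y z ≠ 0) :
    cycleFreeness (starInput n y z) = false := by
  obtain ⟨j, hz, hy⟩ := exists_of_meetingLaw_ne_zero (left_ne_zero_of_mul h)
  classical
  rw [cycleFreeness, decide_eq_false_iff_not]
  exact not_isAcyclic_starInput hn hz hy

/-- The mixture of the hard distributions: all sets disjoint from `y`, or one of them meets it. -/
noncomputable def hardWeight (q : (Fin N → Bool) × (Fin K → Fin N → Bool)) : ℝ :=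
  ∑ i, meetingWeight i q.1 q.2 + 9 / 10 * K * disjointWeight q.1 q.2

theorem hardWeight_nonneg (q : (Fin N → Bool) × (Fin K → Fin N → Bool)) : 0 ≤ hardWeight q :=
  add_nonneg (sum_nonneg fun i _ => meetingWeight_nonneg i _ _)
    (mul_nonneg (by positivity) (disjointWeight_nonneg _ _))

theorem sum_hardWeight_mul (F : (Fin N → Bool) → (Fin K → Fin N → Bool) → ℝ) :
    ∑ q, hardWeight q * F q.1 q.2 = ∑ i, ∑ y, ∑ z, meetingWeight i y z * F y z +
      9 / 10 * K * ∑ y, ∑ z, disjointWeight y z * F y z := by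
  rw [Fintype.sum_prod_type]
  simp only [hardWeight, add_mul, sum_add_distrib, sum_mul, mul_sum]
  congr 1
  · rw [sum_rotate]
  · simp only [mul_assoc]

theorem sum_hardWeight_le [NeZero N] :
    ∑ q : (Fin N → Bool) × (Fin K → Fin N → Bool), hardWeight q ≤ 19 / 10 * K := by
  have h := sum_hardWeight_mul (N := N) (K := K) fun _ _ => 1
  simp only [mul_one, sum_disjointWeight] at h
  rw [h]
  have : ∑ i : Fin K, ∑ y : Fin N → Bool, ∑ z, meetingWeight i y z ≤ ∑ _i : Fin K, (1 : ℝ) :=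
    sum_le_sum fun i _ => sum_meetingWeight_le i
  rw [sum_const, card_univ, Fintype.card_fin, nsmul_eq_mul, mul_one] at this
  linarith

open Classical in
/-- A cheap deterministic protocol errs with large weight under the hard distribution. -/
theorem hardWeight_error_ge [NeZero N] (hn : N + 2 ≤ n) {C b : ℕ} (hb : 20 * C ≤ K * (b + 1))
    (P : DetProtocol (K + 1) (SimpleGraph (Fin n)) Bool)
    (hP : ∀ (y : Fin N → Bool) z, P.HaltsWithin (starInput n y z) C) :
    (81 / 100 - 2 * #(Transcript.shortSet (K + 1) b) * corruptionError N) * K ≤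
      ∑ q : (Fin N → Bool) × (Fin K → Fin N → Bool), hardWeight q *
        if P.Answers (starInput n q.1 q.2) (cycleFreeness (starInput n q.1 q.2)) then 0 else 1 := by
  choose h r hr hC using fun y z => (hP y z).exists_endsAt
  set S := Transcript.shortSet (K + 1) b
  let bad : (Fin N → Bool) → (Fin K → Fin N → Bool) → ℝ := fun y z =>
    if P.Answers (starInput n y z) (cycleFreeness (starInput n y z)) then 0 else 1
  let out : (Fin N → Bool) → (Fin K → Fin N → Bool) → ℝ := fun y z =>
    if P.output (r y z) (starInput n y z (r y z)) ((h y z).view (r y z)) = true then 1 else 0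
  let F : Fin K → (Fin N → Bool) → (Fin K → Fin N → Bool) → ℝ := fun i y z =>
    if (h y z).view i.succ ∈ S then out y z else 0
  have hout0 : ∀ y z, 0 ≤ out y z := fun y z => by simp only [out]; split_ifs <;> norm_num
  have hmeet : ∀ i, ∑ y, ∑ z, meetingWeight i y z * F i y z ≤
      ∑ y, ∑ z, meetingWeight i y z * bad y z := by
    refine fun i => sum_le_sum fun y _ => sum_le_sum fun z _ => ?_
    by_cases hw : meetingWeight i y z = 0
    · simp [hw]
    · refine mul_le_mul_of_nonneg_left ?_ (meetingWeight_nonneg i y z)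
      have hF : F i y z ≤ out y z := by
        simp only [F]; split_ifs; exacts [le_rfl, hout0 y z]
      refine hF.trans ?_
      simp only [out, bad, cycleFreeness_of_meetingWeight_ne_zero hn hw, (hr y z).answers_iff]
      by_cases ho : P.output (r y z) (starInput n y z (r y z)) ((h y z).view (r y z)) = true <;>
        simp [ho]
  have hdisj : ∀ y z, disjointWeight y z * (K - 2 * C / (b + 1) - K * bad y z) ≤
      disjointWeight y z * ∑ i, F i y z := by
    intro y z
    by_cases hw : disjointWeight y z = 0
    · simp [hw]
    refine mul_le_mul_of_nonneg_left ?_ (disjointWeight_nonneg y z)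
    have hpt : ∀ i : Fin K, 1 - (((h y z).view i.succ).bits : ℝ) / (b + 1) - bad y z ≤ F i y z := by
      intro i
      have hfrac : (0 : ℝ) ≤ (((h y z).view i.succ).bits : ℝ) / (b + 1) := by positivity
      simp only [F]
      split_ifs with hS
      · simp only [out, bad, cycleFreeness_of_disjointWeight_ne_zero hw, (hr y z).answers_iff]
        split_ifs <;> linarith
      · have hlong : b + 1 ≤ ((h y z).view i.succ).bits := by
          by_contra hlt
          exact hS (Transcript.mem_shortSet (by omega))
        have : (1 : ℝ) ≤ (((h y z).view i.succ).bits : ℝ) / (b + 1) := by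
          rw [le_div_iff₀ (by positivity), one_mul]
          exact_mod_cast hlong
        have hbad : 0 ≤ bad y z := by simp only [bad]; split_ifs <;> norm_num
        linarith
    have hbits : ∑ i : Fin K, (((h y z).view i.succ).bits : ℝ) ≤ 2 * C := by
      have h1 := Transcript.sum_bits_view_le (h y z)
      rw [Fin.sum_univ_succ] at h1
      have h2 := hC y z
      have : ∑ i : Fin K, ((h y z).view i.succ).bits ≤ 2 * C := by omega
      exact_mod_cast this
    have hsum := sum_le_sum fun i (_ : i ∈ univ) => hpt i
    simp only [sum_sub_distrib, sum_const, card_univ, Fintype.card_fin, nsmul_eq_mul, mul_one,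
      ← sum_div] at hsum
    have := div_le_div_of_nonneg_right hbits (by positivity : (0 : ℝ) ≤ (b : ℝ) + 1)
    linarith
  have hD : K - 2 * C / (b + 1) - K * ∑ y, ∑ z, disjointWeight y z * bad y z ≤
      ∑ i, ∑ y, ∑ z, disjointWeight y z * F i y z := by
    have hsum := sum_le_sum fun y (_ : y ∈ univ) => sum_le_sum fun z (_ : z ∈ univ) => hdisj y z
    have e1 : ∑ y : Fin N → Bool, ∑ z : Fin K → Fin N → Bool,
        disjointWeight y z * ((K : ℝ) - 2 * C / (b + 1) - K * bad y z) =
        K - 2 * C / (b + 1) - K * ∑ y, ∑ z, disjointWeight y z * bad y z := by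
      have : ∀ (y : Fin N → Bool) (z : Fin K → Fin N → Bool),
          disjointWeight y z * ((K : ℝ) - 2 * C / (b + 1) - K * bad y z) =
          disjointWeight y z * ((K : ℝ) - 2 * C / (b + 1)) -
            K * (disjointWeight y z * bad y z) := fun y z => by ring
      simp only [this, sum_sub_distrib, ← sum_mul, ← mul_sum, sum_disjointWeight, one_mul]
    have e2 : ∑ y, ∑ z, disjointWeight y z * ∑ i, F i y z =
        ∑ i, ∑ y, ∑ z, disjointWeight y z * F i y z := by
      simp only [mul_sum]
      rw [sum_rotate]
    linarith
  have hcorr := sum_le_sum fun i (_ : i ∈ univ) =>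
    (meetingWeight_short_ge P hr S i (F := F i) fun y z => rfl).trans (hmeet i)
  rw [sum_sub_distrib, ← mul_sum, sum_const, card_univ, Fintype.card_fin, nsmul_eq_mul] at hcorr
  have hCb : 2 * (C : ℝ) / (b + 1) ≤ K / 10 := by
    rw [div_le_iff₀ (by positivity)]
    have : (20 * C : ℝ) ≤ K * (b + 1) := by exact_mod_cast hb
    linarith
  have := sum_hardWeight_mul bad
  simp only [bad] at this hcorr hD ⊢
  linarith

end StarBound

theorem errorCount_le {k n N C b : ℕ} (hk : 100000 ≤ k) (hkn : k ≤ n) (hN : n ≤ 3 * N)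
    (hb : k * b ≤ 40 * C) (hC : (C : ℝ) < 1 / 100000000 * (k * n / Real.logb 2 k)) :
    2 * (#(Transcript.shortSet k b) : ℝ) * corruptionError N ≤ 6 / 100 := by
  have hk0 : (0 : ℝ) < k := by exact_mod_cast (by omega : 0 < k)
  have hlog : 0 < Real.log k := Real.log_pos (by exact_mod_cast (by omega : 1 < k))
  have hl2 : 0 < Real.log 2 := Real.log_pos (by norm_num)
  have hl2' : Real.log 2 < 1 := Real.log_two_lt_d9.trans (by norm_num)
  have hS : (#(Transcript.shortSet k b) : ℝ) ≤ Real.exp (5 * b * Real.log k) := by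
    have h1 : #(Transcript.shortSet k b) ≤ (k ^ 5) ^ b := by
      refine (Transcript.card_shortSet_le k b).trans (Nat.pow_le_pow_left ?_ b)
      calc 4 * k ^ 2 + 1 ≤ k ^ 2 * 5 := by nlinarith
        _ ≤ k ^ 2 * k ^ 3 := Nat.mul_le_mul_left _ (by nlinarith [Nat.pow_le_pow_left hk 3])
        _ = k ^ 5 := by ring
    have h2 : Real.exp (5 * b * Real.log k) = ((k : ℝ) ^ 5) ^ b := by
      rw [← pow_mul, ← Real.exp_log (pow_pos hk0 (5 * b)), Real.log_pow]
      push_cast; ring_nf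
    rw [h2]
    exact_mod_cast h1
  have hexp : 5 * b * Real.log k ≤ N / 20000 := by
    have h1 : (C : ℝ) * Real.log k ≤ 1 / 100000000 * (k * n) := by
      have h2 : (C : ℝ) < 1 / 100000000 * (k * n) * Real.log 2 / Real.log k := by
        refine hC.trans_le (le_of_eq ?_)
        rw [Real.logb]; field_simp
      rw [lt_div_iff₀ hlog] at h2
      have h3 : 1 / 100000000 * ((k : ℝ) * n) * Real.log 2 ≤ 1 / 100000000 * (k * n) :=
        mul_le_of_le_one_right (by positivity) hl2'.le
      linarith
    have h4 : (k : ℝ) * b ≤ 40 * C := by exact_mod_cast hb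
    have h5 : (n : ℝ) ≤ 3 * N := by exact_mod_cast hN
    have h6 : (k : ℝ) * (5 * b * Real.log k) ≤ k * (N / 20000) := by
      have h7 := mul_le_mul_of_nonneg_right h4 hlog.le
      have h8 := mul_le_mul_of_nonneg_left h5 hk0.le
      nlinarith
    exact le_of_mul_le_mul_left h6 hk0
  have hN' : (100000 : ℝ) / 3 ≤ N := by
    have : (100000 : ℝ) ≤ 3 * N := by exact_mod_cast (by omega : 100000 ≤ 3 * N)
    linarith
  have hprod : (#(Transcript.shortSet k b) : ℝ) * Real.exp (-(N / 20000)) ≤ 1 := by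
    calc _ ≤ Real.exp (N / 20000) * Real.exp (-(N / 20000)) :=
          mul_le_mul_of_nonneg_right (hS.trans (Real.exp_le_exp.2 hexp)) (Real.exp_pos _).le
      _ = 1 := by rw [← Real.exp_add]; simp
  have h1000 : 1000 / (N : ℝ) ≤ 3 / 100 := by
    rw [div_le_iff₀ (by linarith)]; linarith
  calc _ = 2 * (1000 / (N : ℝ)) * (#(Transcript.shortSet k b) * Real.exp (-(N / 20000))) := by
        rw [corruptionError]; ring
    _ ≤ 2 * (1000 / (N : ℝ)) * 1 := mul_le_mul_of_nonneg_left hprod (by positivity)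
    _ ≤ _ := by linarith

theorem cost_ge_of_computes {n m k C : ℕ} (hk : 100000 ≤ k) (hkn : k ≤ n) (hnm : n ≤ m)
    (P : RandProtocol k (SimpleGraph (Fin n)) Bool) (hP : P.CostAtMost (duplicationInputs k n m) C)
    (hδ : P.ComputesWithError (duplicationInputs k n m) cycleFreeness (1 / 3)) :
    1 / 100000000 * (k * n / Real.logb 2 k) ≤ (C : ℝ) := by
  classical
  by_contra! hC
  obtain ⟨K, rfl⟩ : ∃ K, k = K + 1 := ⟨k - 1, by omega⟩
  obtain ⟨N, hN⟩ : ∃ N, N = (n - 1) / 2 := ⟨_, rfl⟩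
  have : NeZero N := ⟨by omega⟩
  have hmem := fun (y : Fin N → Bool) (z : Fin K → Fin N → Bool) =>
    starInput_mem (n := n) (m := m) (by omega) (by omega) y z
  let b := 20 * C / K
  have hKpos : 0 < K := by omega
  have hb : 20 * C ≤ K * (b + 1) := (Nat.lt_mul_div_succ _ hKpos).le
  have hb' : (K + 1) * b ≤ 40 * C := by
    have h1 : K * b ≤ 20 * C := Nat.mul_div_le _ _
    have h2 : b ≤ K * b := Nat.le_mul_of_pos_left _ hKpos
    rw [add_mul]
    omega
  have herr := errorCount_le hk hkn (by omega : n ≤ 3 * N) hb' hC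
  let := P.measurableSpace
  have := P.isProbabilityMeasure
  have hmain := le_of_forall_le_sum_indicator (μ := P.law)
    (c := hardWeight (N := N) (K := K)) hardWeight_nonneg
    (bad := fun q => {ω | ¬ (P.det ω).Answers (starInput n q.1 q.2)
      (cycleFreeness (starInput n q.1 q.2))}) (δ := 1 / 3) (by norm_num)
    (fun q => by
      refine (hδ _ (hmem q.1 q.2)).trans (le_of_eq ?_)
      rw [ENNReal.ofReal_div_of_pos (by norm_num)]
      simp)
    (s := (81 / 100 - 6 / 100) * K) (fun ω => by
      refine le_trans ?_ ((hardWeight_error_ge (by omega) hb (P.det ω)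
        fun y z => hP _ (hmem y z) ω).trans (le_of_eq ?_))
      · exact mul_le_mul_of_nonneg_right (by linarith) (by positivity)
      · refine sum_congr rfl fun q _ => ?_
        rw [Set.indicator_apply]
        by_cases ha : (P.det ω).Answers (starInput n q.1 q.2)
          (cycleFreeness (starInput n q.1 q.2)) <;> simp [ha])
  have htot := sum_hardWeight_le (N := N) (K := K)
  have hK0 : (0 : ℝ) < K := by exact_mod_cast hKpos
  linarith

theorem mainTheorem10 :
    ∃ c₀ : ℝ, 0 < c₀ ∧ ∃ c : ℝ, 0 < c ∧
      ∀ n m k : ℕ, 2 ≤ k → n ≤ m → c₀ * Real.logb 2 n ≤ k → k ≤ min n m →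
        ENNReal.ofReal (c * (k * n / Real.logb 2 k)) ≤
          (randCC (1 / 3) (duplicationInputs k n m) cycleFreeness : ℝ≥0∞) := by
  refine ⟨100000, by norm_num, 1 / 100000000, by norm_num, fun n m k hk hnm hlog hkn => ?_⟩
  have hkn' : k ≤ n := hkn.trans (min_le_left _ _)
  have h1 : 1 ≤ Real.logb 2 n := by
    rw [Real.le_logb_iff_rpow_le (by norm_num) (by exact_mod_cast (by omega : 0 < n))]
    rw [Real.rpow_one]
    exact_mod_cast hk.trans hkn'
  have hk' : 100000 ≤ k := by
    have : (100000 : ℝ) ≤ k := by linarith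
    exact_mod_cast this
  set a : ℝ := 1 / 100000000 * (k * n / Real.logb 2 k)
  have hceil : ((⌈a⌉₊ : ℕ) : ℕ∞) ≤ randCC (1 / 3) (duplicationInputs k n m) cycleFreeness := by
    refine le_iInf₂ fun C ⟨P, hP, hδ⟩ => ?_
    exact Nat.cast_le.2 (Nat.ceil_le.2 (cost_ge_of_computes hk' hkn' hnm P hP hδ))
  calc ENNReal.ofReal a ≤ ENNReal.ofReal (⌈a⌉₊ : ℝ) := ENNReal.ofReal_le_ofReal (Nat.le_ceil a)
    _ = (((⌈a⌉₊ : ℕ) : ℕ∞) : ℝ≥0∞) := by simp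
    _ ≤ _ := by exact_mod_cast hceil
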